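/- Let $p>2$ be a prime and let $R$ be a finite commutative local ring of order $p^{nr}$ with Jacobson radical $J(R)$ such that $F=R/J(R)$ is a field with $p^r$ elements. Let $H(R)=R\oplus Ri\oplus Rj\oplus Rk$ be the quaternion ring over $R$ ($i^2=j^2=k^2=ijk=-1$, with $i,j,k$ commuting with the elements of $R$), and let $J(H(R))$ be its Jacobson radical. An exceptional unit of a ring is a unit $u$ such that $1-u$ is also a unit. For $c\in H(R)$ let $\varphi_2(H(R),c)$ be the number of pairs $(x_1,x_2)$ of exceptional units of $H(R)$ with $x_1+x_2=c$, and let $\overline c=c+J(H(R))\in H(R)/J(H(R))$. Then $$\varphi_2(H(R),c)=\begin{cases} p^{(4n-3)r}\left(p^{3r}-3p^{2r}+6\right), & \text{if } \overline c=0,\\ p^{(4n-3)r}\left(p^{3r}-2p^{2r}-p^r+3\right), & \text{if } \overline c=1,\\ p^{4(n-1)r}\left(p^{4r}-4p^{3r}+5p^{2r}-4p^r+4\right), & \text{if } \overline c\neq 0,1 \text{ is an idempotent},\\ p^{(4n-3)r}\left(p^{3r}-4p^{2r}+3p^r+2\right), & \text{if } \overline c\ne 0 \text{ is nilpotent}.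 \end{cases}$$ If $c$ is invertible, then $\varphi_2(H(R),c)\le p^{(4n-3)r}\left(p^{3r}-2p^{2r}-p^r+3\right)$. Furthermore, if $p^r\ge 9$, then $\varphi_2(H(R),c)\ge p^{(4n-3)r}\left(p^{3r}-8p^{2r}\right)$ for every $c\in H(R)$, and if additionally $\overline c^{\,2}=\lambda\overline c$ for some $\lambda\in F$ with $\lambda\neq 0,1$, then $$\varphi_2(H(R),c)\le \frac{p^{(4n-3)r}}{p^r-8}\left(p^{4r}-4p^{3r}+5p^{2r}-4p^r+4\right).$$ -/

import Mathlib

/-- An exceptional unit of a ring: a unit `u` such that `1 - u` is a unit as well. -/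
def IsExceptionalUnit {A : Type*} [Ring A] (u : A) : Prop :=
  IsUnit u ∧ IsUnit (1 - u)

/-- `phi k c` is the number of `k`-tuples of exceptional units of the ring `A`
whose sum is `c`. -/
noncomputable def phi {A : Type*} [Ring A] (k : ℕ) (c : A) : ℕ :=
  Nat.card {x : Fin k → A // (∀ i, IsExceptionalUnit (x i)) ∧ ∑ i, x i = c}

/-- The class of an element modulo the Jacobson radical. -/
abbrev modJ {A : Type*} [Ring A] (c : A) : A ⧸ Ring.jacobson A :=
  Ideal.Quotient.mk (Ring.jacobson A) c

/-! Let `F` be the residue field and q = p^r its order. As p is odd, -1 is a sum of two squares in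
`F`, and this gives a surjection `quaternionToMatrix` from H(R) onto the 2 × 2 matrices over `F`
that carries the norm to the determinant. It detects units, and its kernel is the Jacobson radical,
of order p^(4(n-1)r). Hence φ₂(c) is that order times `exceptionalCount`, the number of matrices x
for which x, 1 - x, c - x and 1 - (c - x) are all invertible (`phi_two_quaternion_eq`).

This number depends only on the conjugacy class of the image of c, so the exact formulas reduce to
0, 1, E₁₁ and E₁₂. For x = (a, b; e, d) each of the four determinants is a function of a, d, e minus
b * e. The conditions thus say that b * e avoids a set of at most four values, and counting amounts
to finding where these values coincide.

The bounds are softer: dropping the conditions on c - x leaves exactly the count for c = 1, and a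
union bound over the four singular loci gives the lower estimate. The last inequality compares the
former bound, valid for every c, with a polynomial in q. -/

set_option linter.unusedSectionVars false

/-! ### Counting 2 × 2 matrices by the product of their off-diagonal entries -/

section Counting

open Finset

variable {F : Type*} [Field F] [Fintype F] [DecidableEq F]

/-- The exceptional unit condition for `x` and `c - x`, in terms of determinants. -/
def IsExceptionalSummand (c x : Matrix (Fin 2) (Fin 2) F) : Prop :=
  (x.det ≠ 0 ∧ (1 - x).det ≠ 0) ∧ (c - x).det ≠ 0 ∧ (1 - (c - x)).det ≠ 0

/-- The number of ways to write `c` as an ordered sum of two exceptional units. -/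
noncomputable def exceptionalCount (c : Matrix (Fin 2) (Fin 2) F) : ℕ :=
  Nat.card {x // IsExceptionalSummand c x}

theorem card_matrix_eq_sum (P : Matrix (Fin 2) (Fin 2) F → Prop) [DecidablePred P] :
    (Nat.card {x // P x} : ℤ) =
      ∑ a : F, ∑ d : F, ∑ e : F, ∑ b : F, if P !![a, b; e, d] then 1 else 0 := by
  let E : F × F × F × F ≃ Matrix (Fin 2) (Fin 2) F :=
    { toFun := fun t => !![t.1, t.2.2.2; t.2.2.1, t.2.1]
      invFun := fun x => (x 0 0, x 1 1, x 1 0, x 0 1)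
      left_inv := fun t => by simp
      right_inv := fun x => by ext i j; fin_cases i <;> fin_cases j <;> rfl }
  rw [Nat.card_eq_fintype_card, Fintype.card_subtype, card_filter]
  push_cast
  rw [← E.sum_comp]
  simp only [Fintype.sum_prod_type]
  rfl

/-- Multiplication by e is a bijection of `F` when e ≠ 0, while for e = 0 the product is always 0,
so the answer is all or nothing. -/
theorem sum_mul_notMem (e : F) (T : Finset F) :
    (∑ b : F, if b * e ∉ T then (1 : ℤ) else 0) =
      if e = 0 then (if 0 ∈ T then 0 else (Fintype.card F : ℤ)) else Fintype.card F - #T := by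
  split_ifs with he h0
  · simp [he, h0]
  · simp [he, h0]
  · have := Equiv.sum_comp (Equiv.mulRight₀ e he) (fun t => if t ∉ T then (1 : ℤ) else 0)
    rw [show (∑ b : F, if b * e ∉ T then (1 : ℤ) else 0) = _ from this, sum_boole, filter_notMem_eq_sdiff, ← compl_eq_univ_sdiff, card_compl,
      Nat.cast_sub (card_le_univ T)]

theorem card_matrix_eq_sum_of_iff {P : Matrix (Fin 2) (Fin 2) F → Prop} (T : F → F → F → Finset F)
    (h : ∀ a b e d, P !![a, b; e, d] ↔ b * e ∉ T a d e) :
    (Nat.card {x // P x} : ℤ) = ∑ a : F, ∑ d : F, ∑ e : F,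
      if e = 0 then (if 0 ∈ T a d 0 then 0 else (Fintype.card F : ℤ))
      else Fintype.card F - #(T a d e) := by
  classical
  rw [card_matrix_eq_sum]
  refine sum_congr rfl fun a _ => sum_congr rfl fun d _ => sum_congr rfl fun e _ => ?_
  simp only [h, sum_mul_notMem]
  split_ifs <;> simp_all

theorem sum_ite_zero_const (x y : ℤ) :
    (∑ e : F, if e = 0 then x else y) = x + (Fintype.card F - 1) * y := by
  rw [← add_sum_erase _ _ (mem_univ (0 : F)), if_pos rfl,
    sum_congr rfl (fun e he => if_neg (ne_of_mem_erase he)), sum_const,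
    card_erase_of_mem (mem_univ _), card_univ, nsmul_eq_mul, Nat.cast_sub Fintype.card_pos]
  simp

theorem sum_sum_ite_mem_or_mem (A B : Finset F) (z : ℤ) :
    (∑ a : F, ∑ d : F, if a ∈ A ∨ d ∈ B then 0 else z) =
      z * (Fintype.card F - #A) * (Fintype.card F - #B) := by
  have key (S : Finset F) : (∑ a : F, if a ∈ S then (0 : ℤ) else 1) = Fintype.card F - #S := by
    have := sum_mul_notMem (1 : F) S
    simpa [ite_not] using this
  rw [← key, ← key, mul_assoc, sum_mul_sum, mul_sum]
  refine sum_congr rfl fun a _ => ?_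
  rw [mul_sum]
  refine sum_congr rfl fun d _ => ?_
  by_cases a ∈ A <;> by_cases d ∈ B <;> simp [*]

/-- The count when the forbidden values of `b * e` do not depend on `e`. -/
theorem card_matrix_of_const {P : Matrix (Fin 2) (Fin 2) F → Prop} (T : F → F → Finset F)
    (A B : Finset F) (h : ∀ a b e d, P !![a, b; e, d] ↔ b * e ∉ T a d)
    (h0 : ∀ a d, 0 ∈ T a d ↔ a ∈ A ∨ d ∈ B) (m : ℤ)
    (hm : (∑ a : F, ∑ d : F, (#(T a d) : ℤ)) = m) :
    (Nat.card {x // P x} : ℤ) =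
      Fintype.card F * (Fintype.card F - #A) * (Fintype.card F - #B) +
        (Fintype.card F - 1) * ((Fintype.card F : ℤ) ^ 3 - m) := by
  rw [card_matrix_eq_sum_of_iff (fun a d _ => T a d) h]
  simp only [sum_ite_zero_const, sum_add_distrib, h0, sum_sum_ite_mem_or_mem]
  congr 1
  simp only [← mul_sum, sum_sub_distrib, hm, sum_const, card_univ, nsmul_eq_mul]
  ring

theorem sum_boole_eq (a : F) (z : ℤ) : (∑ d : F, if d = a then z else 0) = z := by simp

theorem cast_card_pair (y z : F) : (#({y, z} : Finset F) : ℤ) = 2 - if y = z then 1 else 0 := by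
  split_ifs with h <;> simp [h]

theorem cast_card_three (x y z : F) : (#({x, y, z} : Finset F) : ℤ) =
    3 - (if y = z then 1 else 0) - (if x = y ∨ x = z then 1 else 0) := by
  rw [card_insert_eq_ite]
  have := cast_card_pair y z
  simp only [mem_insert, mem_singleton]
  split_ifs at * <;> push_cast <;> linarith

theorem cast_card_four (w x y z : F) : (#({w, x, y, z} : Finset F) : ℤ) =
    4 - (if y = z then 1 else 0) - (if x = y ∨ x = z then 1 else 0) -
      (if w = x ∨ w = y ∨ w = z then 1 else 0) := by
  rw [card_insert_eq_ite]
  have := cast_card_three x y z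
  simp only [mem_insert, mem_singleton]
  split_ifs at * <;> push_cast <;> linarith

/-- The exact number is q³ + q² - q; the cruder bound suffices for the union bound in
`le_exceptionalCount`. -/
theorem card_det_eq_zero_le :
    (Nat.card {x : Matrix (Fin 2) (Fin 2) F // x.det = 0} : ℤ) ≤ 2 * (Fintype.card F : ℤ) ^ 3 := by
  have h1 := card_matrix_of_const (F := F) (P := fun x => x.det ≠ 0) (fun a d => {a * d}) {0} {0}
    (fun a b e d => by rw [Matrix.det_fin_two_of, mem_singleton, sub_ne_zero, ne_comm])
    (fun a d => by simp [eq_comm (a := (0 : F))]) (Fintype.card F ^ 2) (by simp [sq])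
  have h2 := Nat.card_congr (Equiv.sumCompl fun x : Matrix (Fin 2) (Fin 2) F => x.det = 0)
  rw [Nat.card_sum, Nat.card_eq_fintype_card (α := Matrix _ _ F)] at h2
  have h3 : Fintype.card (Matrix (Fin 2) (Fin 2) F) = Fintype.card F ^ 4 := by
    rw [← Nat.card_eq_fintype_card, Nat.card_congr (Matrix.of (m := Fin 2) (n := Fin 2)).symm]
    simp [← pow_mul]
  rw [h3] at h2
  have h4 : (0 : ℤ) < Fintype.card F := mod_cast Fintype.card_pos
  zify at h2
  simp only [card_singleton, Nat.cast_one] at h1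
  rw [h1] at h2
  nlinarith [sq_nonneg ((Fintype.card F : ℤ) - 1)]

/-! ### The four normal forms: 0, 1, E₁₁ and E₁₂ -/

theorem exceptionalCount_zero (h2 : (2 : F) ≠ 0) :
    (exceptionalCount (0 : Matrix (Fin 2) (Fin 2) F) : ℤ) =
      Fintype.card F * ((Fintype.card F : ℤ) ^ 3 - 3 * Fintype.card F ^ 2 + 6) := by
  have h11 : (1 : F) ≠ -1 := fun h => h2 (by linear_combination h)
  have hc : #({0, 1, -1} : Finset F) = 3 := by
    rw [card_eq_three]; exact ⟨0, 1, -1, by simp, by simp, h11, rfl⟩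
  rw [exceptionalCount, card_matrix_of_const
    (fun a d => {a * d, (1 - a) * (1 - d), (1 + a) * (1 + d)}) {0, 1, -1} {0, 1, -1} ?_ ?_
    (Fintype.card F * (3 * Fintype.card F - 3)) ?_]
  · simp only [hc]; push_cast; ring
  · intro a b e d
    simp only [IsExceptionalSummand, Matrix.one_fin_two, Matrix.det_fin_two, Matrix.sub_apply,
      Matrix.of_apply, Matrix.cons_val', Matrix.cons_val_zero, Matrix.cons_val_one,
      Matrix.zero_apply, Matrix.cons_val_fin_one, mem_insert, mem_singleton]
    grind
  · intro a d
    simp only [mem_insert, mem_singleton, zero_eq_mul]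
    grind
  -- Coincidences occur on three parallel lines, which are pairwise disjoint unless 2 = 0; so the
  -- cardinality drops by one on each.
  · have key (a d : F) : (#({a * d, (1 - a) * (1 - d), (1 + a) * (1 + d)} : Finset F) : ℤ) =
        3 - (if d = -a then 1 else 0) - (if d = 1 - a then 1 else 0) -
          (if d = -1 - a then 1 else 0) := by
      rw [cast_card_three]
      have e1 : (1 - a) * (1 - d) = (1 + a) * (1 + d) ↔ d = -a := by grind
      have e2 : a * d = (1 - a) * (1 - d) ↔ d = 1 - a := by grind
      have e3 : a * d = (1 + a) * (1 + d) ↔ d = -1 - a := by grind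
      simp only [e1, e2, e3]
      grind
    simp only [key, sum_sub_distrib, sum_boole_eq]
    simp [mul_sub]; ring

theorem exceptionalCount_one :
    (exceptionalCount (1 : Matrix (Fin 2) (Fin 2) F) : ℤ) =
      Fintype.card F * ((Fintype.card F : ℤ) ^ 3 - 2 * Fintype.card F ^ 2 - Fintype.card F + 3) := by
  have hc : #({0, 1} : Finset F) = 2 := card_pair zero_ne_one
  rw [exceptionalCount, card_matrix_of_const
    (fun a d => {a * d, (1 - a) * (1 - d)}) {0, 1} {0, 1} ?_ ?_
    (Fintype.card F * (2 * Fintype.card F - 1)) ?_]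
  · simp only [hc]; push_cast; ring
  · intro a b e d
    simp only [IsExceptionalSummand, Matrix.one_fin_two, Matrix.det_fin_two, Matrix.sub_apply,
      Matrix.of_apply, Matrix.cons_val', Matrix.cons_val_zero, Matrix.cons_val_one,
      Matrix.cons_val_fin_one, mem_insert, mem_singleton]
    grind
  · intro a d
    simp only [mem_insert, mem_singleton, zero_eq_mul]
    grind
  · have key (a d : F) : (#({a * d, (1 - a) * (1 - d)} : Finset F) : ℤ) =
        2 - (if d = 1 - a then 1 else 0) := by
      rw [cast_card_pair]
      have e2 : a * d = (1 - a) * (1 - d) ↔ d = 1 - a := by grind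
      simp only [e2]
    simp only [key, sum_sub_distrib, sum_boole_eq]
    simp [mul_sub]; ring

theorem exceptionalCount_idempotent (h2 : (2 : F) ≠ 0) :
    (exceptionalCount (!![1, 0; 0, 0] : Matrix (Fin 2) (Fin 2) F) : ℤ) =
      (Fintype.card F : ℤ) ^ 4 - 4 * Fintype.card F ^ 3 + 5 * Fintype.card F ^ 2
        - 4 * Fintype.card F + 4 := by
  have h11 : (1 : F) ≠ -1 := fun h => h2 (by linear_combination h)
  have hc : #({0, 1, -1} : Finset F) = 3 := by
    rw [card_eq_three]; exact ⟨0, 1, -1, by simp, by simp, h11, rfl⟩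
  have hc' : #({0, 1} : Finset F) = 2 := card_pair zero_ne_one
  rw [exceptionalCount, card_matrix_of_const
    (fun a d => {a * (1 + d), (a - 1) * d, (1 - a) * (1 - d), a * d}) {0, 1} {0, 1, -1} ?_ ?_
    (4 * (Fintype.card F : ℤ) ^ 2 - 6 * Fintype.card F + 4) ?_]
  · simp only [hc, hc']; push_cast; ring
  · intro a b e d
    simp only [IsExceptionalSummand, Matrix.one_fin_two, Matrix.det_fin_two, Matrix.sub_apply,
      Matrix.of_apply, Matrix.cons_val', Matrix.cons_val_zero, Matrix.cons_val_one,
      Matrix.cons_val_fin_one, mem_insert, mem_singleton]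
    grind
  · intro a d
    simp only [mem_insert, mem_singleton, zero_eq_mul]
    grind
  -- The six possible coincidences are lines in the (a, d)-plane. The brackets are
  -- inclusion–exclusion for a union of two and of three lines; the last correction is the point (1,
  -- -1), where d = 1 - 2a meets d = -a.
  · have key (a d : F) :
        (#({a * (1 + d), (a - 1) * d, (1 - a) * (1 - d), a * d} : Finset F) : ℤ) =
        4 - (if d = 1 - a then 1 else 0) -
          ((if d = 0 then 1 else 0) + (if a = 1 then 1 else 0)
            - (if d = 0 then (if a = 1 then 1 else 0) else 0)) -
          ((if a = 0 then 1 else 0) + (if d = 1 - 2 * a then 1 else 0) +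
            (if d = -a then 1 else 0) - (if d = 1 - 2 * a then (if a = 0 then 1 else 0) else 0)
            - (if d = -a then (if a = 0 then 1 else 0) else 0) -
            (if d = -a then (if a = 1 then 1 else 0) else 0)) := by
      rw [cast_card_four]
      have e1 : (1 - a) * (1 - d) = a * d ↔ d = 1 - a := by grind
      have e2 : (a - 1) * d = (1 - a) * (1 - d) ↔ a = 1 := by grind
      have e3 : (a - 1) * d = a * d ↔ d = 0 := by grind
      have e4 : a * (1 + d) = (a - 1) * d ↔ d = -a := by grind
      have e5 : a * (1 + d) = (1 - a) * (1 - d) ↔ d = 1 - 2 * a := by grind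
      have e6 : a * (1 + d) = a * d ↔ a = 0 := by grind
      simp only [e1, e2, e3, e4, e5, e6]
      congr 1
      · congr 1
        split_ifs <;> simp_all
      · by_cases a0 : a = 0
        · subst a0; simp; ring
        · by_cases a1 : a = 1
          · subst a1; norm_num
          · by_cases d1 : d = -a
            · have : -a ≠ 1 - 2 * a := by grind
              simp [a0, a1, d1, this]
            · simp [*]
    simp only [key, sum_sub_distrib, sum_add_distrib, sum_boole_eq]
    simp; ring

theorem exceptionalCount_nilpotent (h2 : (2 : F) ≠ 0) :
    (exceptionalCount (!![0, 1; 0, 0] : Matrix (Fin 2) (Fin 2) F) : ℤ) =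
      Fintype.card F * ((Fintype.card F : ℤ) ^ 3 - 4 * Fintype.card F ^ 2
        + 3 * Fintype.card F + 2) := by
  have h11 : (1 : F) ≠ -1 := fun h => h2 (by linear_combination h)
  have hc : #({0, 1, -1} : Finset F) = 3 := by
    rw [card_eq_three]; exact ⟨0, 1, -1, by simp, by simp, h11, rfl⟩
  rw [exceptionalCount, card_matrix_eq_sum_of_iff
    (fun a d e => {(1 + a) * (1 + d) + e, a * d + e, (1 - a) * (1 - d), a * d}) ?_]
  · have h0 (a d : F) : (0 ∈ ({(1 + a) * (1 + d) + 0, a * d + 0, (1 - a) * (1 - d), a * d} :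
        Finset F)) ↔ a ∈ ({0, 1, -1} : Finset F) ∨ d ∈ ({0, 1, -1} : Finset F) := by
      simp only [mem_insert, mem_singleton, add_zero, zero_eq_mul]
      grind
    -- The last bracket counts a union of three parallel lines. For e ≠ 0 two of them coincide only
    -- when e = 2 or e = -2, whence the two correction terms.
    have key (a d e : F) (he : e ≠ 0) :
        (#({(1 + a) * (1 + d) + e, a * d + e, (1 - a) * (1 - d), a * d} : Finset F) : ℤ) =
        4 - (if d = 1 - a then 1 else 0) - (if d = 1 - a - e then 1 else 0) -
          ((if d = -1 - a - e then 1 else 0) + (if d = -a - e / 2 then 1 else 0) +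
            (if d = -1 - a then 1 else 0) - (if d = -1 - a then (if e = 2 then 1 else 0) else 0)
            - (if d = -1 - a - e then (if e = -2 then 1 else 0) else 0)) := by
      rw [cast_card_four]
      have e1 : (1 - a) * (1 - d) = a * d ↔ d = 1 - a := by grind
      have e2 : a * d + e = (1 - a) * (1 - d) ↔ d = 1 - a - e := by grind
      have e3 : a * d + e = a * d ↔ False := by grind
      have e4 : (1 + a) * (1 + d) + e = a * d + e ↔ d = -1 - a := by grind
      have e5 : (1 + a) * (1 + d) + e = (1 - a) * (1 - d) ↔ d = -a - e / 2 := by grind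
      have e6 : (1 + a) * (1 + d) + e = a * d ↔ d = -1 - a - e := by grind
      simp only [e1, e2, e3, e4, e5, e6, or_false]
      congr 1
      by_cases d1 : d = -1 - a
      · have n1 : d ≠ -1 - a - e := by grind
        have n2 : d = -a - e / 2 ↔ e = 2 := by grind
        subst d1; split_ifs <;> simp_all
      · by_cases d2 : d = -1 - a - e
        · have n2 : d = -a - e / 2 ↔ e = -2 := by grind
          subst d2; split_ifs <;> simp_all
        · simp [*]
    have inner (e : F) (he : e ≠ 0) : (∑ a : F, ∑ d : F, ((Fintype.card F : ℤ) -
        #({(1 + a) * (1 + d) + e, a * d + e, (1 - a) * (1 - d), a * d} : Finset F))) =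
        Fintype.card F * ((Fintype.card F : ℤ) ^ 2 - 4 * Fintype.card F + 5
          - (if e = 2 then 1 else 0) - (if e = -2 then 1 else 0)) := by
      simp only [key _ _ e he, sum_sub_distrib, sum_add_distrib, sum_boole_eq, sum_const, card_univ,
        nsmul_eq_mul]
      ring
    have swap (f : F → F → F → ℤ) : (∑ a, ∑ d, ∑ e, f a d e) = ∑ e, ∑ a, ∑ d, f a d e := by
      rw [sum_congr rfl fun a _ => sum_comm, sum_comm]
    rw [swap, ← add_sum_erase _ _ (mem_univ (0 : F))]
    simp only [if_true, h0, sum_sum_ite_mem_or_mem, hc]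
    rw [sum_congr rfl (g := fun e => Fintype.card F * ((Fintype.card F : ℤ) ^ 2
      - 4 * Fintype.card F + 5 - (if e = 2 then 1 else 0) - (if e = -2 then 1 else 0)))
      fun e he => by
        simp only [if_neg (ne_of_mem_erase he), inner e (ne_of_mem_erase he)]]
    have := add_sum_erase univ (fun e => (Fintype.card F : ℤ) * ((Fintype.card F : ℤ) ^ 2
      - 4 * Fintype.card F + 5 - (if e = 2 then 1 else 0) - (if e = -2 then 1 else 0)))
      (mem_univ (0 : F))
    rw [← eq_sub_iff_add_eq'] at this
    rw [this]
    simp only [← mul_sum, sum_sub_distrib, sum_boole_eq]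
    have h2' : (0 : F) ≠ -2 := by simpa [eq_comm] using h2
    simp only [if_neg h2.symm, if_neg h2', sum_const, card_univ, nsmul_eq_mul]
    push_cast
    ring
  · intro a b e d
    simp only [IsExceptionalSummand, Matrix.one_fin_two, Matrix.det_fin_two, Matrix.sub_apply,
      Matrix.of_apply, Matrix.cons_val', Matrix.cons_val_zero, Matrix.cons_val_one,
      Matrix.cons_val_fin_one, mem_insert, mem_singleton]
    grind

end Counting
open Quaternion

/-! ### Reduction of the quaternion ring to 2 × 2 matrices over the residue field -/

section QuaternionReduction

theorem exists_sq_add_sq_eq_neg_one {F : Type*} [Field F] [Finite F] (h2 : (2 : F) ≠ 0) :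
    ∃ α β : F, α ^ 2 + β ^ 2 = -1 := by
  classical
  have := Fintype.ofFinite F
  have hodd : Fintype.card F % 2 = 1 := by
    refine FiniteField.odd_card_of_char_ne_two fun h => h2 ?_
    have := ringChar.Nat.cast_ringChar (R := F)
    rwa [h] at this
  obtain ⟨α, β, h⟩ := FiniteField.exists_root_sum_quadratic
    (f := (Polynomial.X ^ 2 : Polynomial F)) (g := Polynomial.X ^ 2 - Polynomial.C (-1))
    (Polynomial.degree_X_pow 2) (Polynomial.degree_X_pow_sub_C (by decide) _) hodd
  exact ⟨α, β, by simpa [add_eq_zero_iff_eq_neg, ← add_assoc] using h⟩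

variable {R F : Type*} [CommRing R] [Field F]

/-- The ring homomorphism from the quaternions over `R` to the `2 × 2` matrices over a field `F`
determined by a ring homomorphism `R → F` and a solution of `α ^ 2 + β ^ 2 = -1` in `F`. -/
def quaternionToMatrix (π : R →+* F) (α β : F) (h : α ^ 2 + β ^ 2 = -1) :
    ℍ[R] →+* Matrix (Fin 2) (Fin 2) F where
  toFun x := !![π x.re + π x.imI * α - π x.imK * β, π x.imI * β + π x.imJ + π x.imK * α;
    π x.imI * β - π x.imJ + π x.imK * α, π x.re - π x.imI * α + π x.imK * β]
  map_one' := by simp [Matrix.one_fin_two]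
  map_zero' := by ext i j; fin_cases i <;> fin_cases j <;> simp
  map_add' x y := by
    ext i j; fin_cases i <;> fin_cases j <;> simp <;> ring
  map_mul' x y := by
    ext i j; fin_cases i <;> fin_cases j <;> simp [Matrix.mul_apply, Fin.sum_univ_two]
    · linear_combination (-π x.imI * π y.imI - π x.imK * π y.imK) * h
    · linear_combination (π x.imK * π y.imI - π x.imI * π y.imK) * h
    · linear_combination (π x.imI * π y.imK - π x.imK * π y.imI) * h
    · linear_combination (-π x.imI * π y.imI - π x.imK * π y.imK) * h

variable (π : R →+* F) (α β : F) (h : α ^ 2 + β ^ 2 = -1)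

theorem det_quaternionToMatrix (x : ℍ[R]) :
    (quaternionToMatrix π α β h x).det = π (normSq x) := by
  simp only [quaternionToMatrix, RingHom.coe_mk, MonoidHom.coe_mk, OneHom.coe_mk,
    Matrix.det_fin_two_of, normSq_def', map_add, map_pow]
  linear_combination (-π x.imI ^ 2 - π x.imK ^ 2) * h

theorem isUnit_iff_isUnit_normSq (x : ℍ[R]) : IsUnit x ↔ IsUnit (normSq x) := by
  refine ⟨fun hx => hx.map normSq, fun hx => ?_⟩
  obtain ⟨u, hu⟩ := hx
  refine isUnit_iff_exists.mpr ⟨star x * ((↑u⁻¹ : R) : ℍ[R]), ?_, ?_⟩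
  · rw [← mul_assoc, self_mul_star, ← hu, ← coe_mul, Units.mul_inv, coe_one]
  · rw [mul_assoc, coe_commutes, ← mul_assoc, star_mul_self, ← hu, ← coe_mul, Units.mul_inv,
      coe_one]

theorem isUnit_iff_det_quaternionToMatrix_ne_zero [IsLocalHom π] (x : ℍ[R]) :
    IsUnit x ↔ (quaternionToMatrix π α β h x).det ≠ 0 := by
  rw [det_quaternionToMatrix, isUnit_iff_isUnit_normSq, ← isUnit_map_iff π, isUnit_iff_ne_zero]

theorem quaternionToMatrix_eq_zero_iff (h2 : (2 : F) ≠ 0) (x : ℍ[R]) :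
    quaternionToMatrix π α β h x = 0 ↔
      π x.re = 0 ∧ π x.imI = 0 ∧ π x.imJ = 0 ∧ π x.imK = 0 := by
  constructor
  · intro hx
    have h00 := congrFun (congrFun hx 0) 0
    have h01 := congrFun (congrFun hx 0) 1
    have h10 := congrFun (congrFun hx 1) 0
    have h11 := congrFun (congrFun hx 1) 1
    simp [quaternionToMatrix] at h00 h01 h10 h11
    have a1 : π x.re = 0 := mul_left_cancel₀ h2 (by linear_combination h00 + h11)
    have a3 : π x.imJ = 0 := mul_left_cancel₀ h2 (by linear_combination h01 - h10)
    rw [a1] at h00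
    rw [a3] at h01
    exact ⟨a1, by linear_combination (-α) * h00 - β * h01 + π x.imI * h, a3,
      by linear_combination β * h00 - α * h01 + π x.imK * h⟩
  · rintro ⟨h1, h2, h3, h4⟩
    ext i j; fin_cases i <;> fin_cases j <;> simp [quaternionToMatrix, *]

theorem quaternionToMatrix_surjective (h2 : (2 : F) ≠ 0) (hπ : Function.Surjective π) :
    Function.Surjective (quaternionToMatrix π α β h) := by
  intro m
  -- Half-sums and half-differences of entries isolate the real and j parts. The i and k parts solve
  -- a linear system with matrix (α, -β; β, α), whose determinant α² + β² = -1 accounts for the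
  -- signs.
  obtain ⟨w, hw⟩ := hπ ((m 0 0 + m 1 1) / 2)
  obtain ⟨y, hy⟩ := hπ ((m 0 1 - m 1 0) / 2)
  obtain ⟨x, hx⟩ := hπ (-(α * (m 0 0 - m 1 1) / 2 + β * (m 0 1 + m 1 0) / 2))
  obtain ⟨z, hz⟩ := hπ (β * (m 0 0 - m 1 1) / 2 - α * (m 0 1 + m 1 0) / 2)
  refine ⟨⟨w, x, y, z⟩, ?_⟩
  ext i j; fin_cases i <;> fin_cases j <;> simp [quaternionToMatrix, hw, hx, hy, hz] <;> field_simp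
  · linear_combination (m 1 1 - m 0 0) * h
  · linear_combination (-m 0 1 - m 1 0) * h
  · linear_combination (-m 0 1 - m 1 0) * h
  · linear_combination (m 0 0 - m 1 1) * h

/-- If x maps to 0, then 1 + y * x maps to 1 and is a unit for every y, so x lies in the radical.
Conversely, a surjection sends the radical into that of the matrix ring, which is zero by
semisimplicity. -/
theorem ker_quaternionToMatrix [IsLocalHom π] (h2 : (2 : F) ≠ 0) (hπ : Function.Surjective π) :
    RingHom.ker (quaternionToMatrix π α β h) = Ring.jacobson ℍ[R] := by
  have hs := quaternionToMatrix_surjective π α β h h2 hπ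
  apply le_antisymm
  · intro x hx
    rw [RingHom.mem_ker] at hx
    rw [← Ideal.jacobson_bot, Ideal.mem_jacobson_iff]
    intro y
    have hu : IsUnit (1 + y * x) := by
      rw [isUnit_iff_det_quaternionToMatrix_ne_zero π α β h, map_add, map_mul, hx]
      simp
    obtain ⟨u, hu⟩ := hu
    refine ⟨↑u⁻¹, ?_⟩
    have : (↑u⁻¹ : ℍ[R]) * (1 + y * x) = 1 := by rw [← hu, Units.inv_mul]
    rw [Ideal.mem_bot, sub_eq_zero, ← this]
    noncomm_ring
  · intro x hx
    have : RingHomSurjective (quaternionToMatrix π α β h) := ⟨hs⟩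
    have hb : Ring.jacobson (Matrix (Fin 2) (Fin 2) F) = ⊥ :=
      IsArtinianRing.isSemisimpleRing_iff_jacobson.mp inferInstance
    have := Ring.le_comap_jacobson (quaternionToMatrix π α β h) hx
    rw [hb] at this
    exact this

theorem card_ker_quaternionToMatrix (h2 : (2 : F) ≠ 0) :
    Nat.card (RingHom.ker (quaternionToMatrix π α β h)) = Nat.card (RingHom.ker π) ^ 4 := by
  let e : RingHom.ker (quaternionToMatrix π α β h) ≃ (Fin 4 → RingHom.ker π) :=
    { toFun := fun x => ![⟨x.1.re, ((quaternionToMatrix_eq_zero_iff π α β h h2 _).1 x.2).1⟩,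
        ⟨x.1.imI, ((quaternionToMatrix_eq_zero_iff π α β h h2 _).1 x.2).2.1⟩,
        ⟨x.1.imJ, ((quaternionToMatrix_eq_zero_iff π α β h h2 _).1 x.2).2.2.1⟩,
        ⟨x.1.imK, ((quaternionToMatrix_eq_zero_iff π α β h h2 _).1 x.2).2.2.2⟩]
      invFun := fun v => ⟨⟨v 0, v 1, v 2, v 3⟩,
        (quaternionToMatrix_eq_zero_iff π α β h h2 _).2 ⟨(v 0).2, (v 1).2, (v 2).2, (v 3).2⟩⟩
      left_inv := fun x => rfl
      right_inv := fun v => by ext i; fin_cases i <;> rfl }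
  rw [Nat.card_congr e, Nat.card_fun, Nat.card_fin]

/-- Fibres of a surjective homomorphism are cosets of the kernel; a set-theoretic section
trivialises them. -/
theorem card_preimage_eq_card_ker_mul {A B : Type*} [Ring A] [Ring B] (f : A →+* B)
    (hf : Function.Surjective f) (P : B → Prop) :
    Nat.card {x // P (f x)} = Nat.card (RingHom.ker f) * Nat.card {y // P y} := by
  let s := Function.surjInv hf
  have hs (y) : f (s y) = y := Function.surjInv_eq hf y
  let e : {x // P (f x)} ≃ RingHom.ker f × {y // P y} :=
    { toFun := fun x => (⟨x - s (f x), by simp [RingHom.mem_ker, hs]⟩, ⟨f x, x.2⟩)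
      invFun := fun t => ⟨t.1 + s t.2, by
        have := RingHom.mem_ker.1 t.1.2
        simpa [this, hs] using t.2.2⟩
      left_inv := fun x => by simp
      right_inv := fun t => by
        have := RingHom.mem_ker.1 t.1.2
        ext <;> simp [this, hs] }
  rw [Nat.card_congr e, Nat.card_prod]

end QuaternionReduction

theorem phi_two_eq {A : Type*} [Ring A] (c : A) :
    phi 2 c = Nat.card {x : A // IsExceptionalUnit x ∧ IsExceptionalUnit (c - x)} := by
  refine Nat.card_congr
    { toFun := fun x => ⟨x.1 0, x.2.1 0, ?_⟩
      invFun := fun x => ⟨![x.1, c - x.1], ?_, ?_⟩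
      left_inv := fun x => ?_
      right_inv := fun x => rfl }
  · have := x.2.2
    rw [Fin.sum_univ_two] at this
    rw [← eq_sub_iff_add_eq'] at this
    rw [← this]
    exact x.2.1 1
  · intro i; fin_cases i
    exacts [x.2.1, x.2.2]
  · simp
  · have := x.2.2
    rw [Fin.sum_univ_two] at this
    ext i; fin_cases i
    · rfl
    · simp [← this]

/-! ### Conjugation invariance, normal forms and general bounds -/

section Conjugation

open Matrix

variable {F : Type*} [Field F]

theorem exceptionalCount_eq_of_mul_eq_mul {c c' P : Matrix (Fin 2) (Fin 2) F} (hP : P.det ≠ 0)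
    (h : c * P = P * c') : exceptionalCount c = exceptionalCount c' := by
  have hu : IsUnit P.det := isUnit_iff_ne_zero.mpr hP
  have key (x y : Matrix (Fin 2) (Fin 2) F) (hxy : x * P = P * y) : x.det = y.det := by
    have := congrArg det hxy
    rw [det_mul, det_mul, mul_comm] at this
    exact mul_left_cancel₀ hP this
  let e : Matrix (Fin 2) (Fin 2) F ≃ Matrix (Fin 2) (Fin 2) F :=
    { toFun := fun x => P⁻¹ * x * P
      invFun := fun x => P * x * P⁻¹
      left_inv := fun x => by
        change P * (P⁻¹ * x * P) * P⁻¹ = x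
        rw [mul_assoc, mul_assoc, mul_assoc, mul_nonsing_inv P hu, mul_one,
          mul_nonsing_inv_cancel_left P x hu]
      right_inv := fun x => by
        change P⁻¹ * (P * x * P⁻¹) * P = x
        rw [mul_assoc, mul_assoc, mul_assoc, nonsing_inv_mul P hu, mul_one,
          nonsing_inv_mul_cancel_left P x hu] }
  refine Nat.card_congr (e.subtypeEquiv fun x => ?_)
  have hx : x * P = P * e x := by
    simp only [e, Equiv.coe_fn_mk]
    rw [mul_assoc, mul_nonsing_inv_cancel_left P _ hu]
  have h1 : (1 - x) * P = P * (1 - e x) := by rw [sub_mul, mul_sub, hx, one_mul, mul_one]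
  have h2 : (c - x) * P = P * (c' - e x) := by rw [sub_mul, mul_sub, hx, h]
  have h3 : (1 - (c - x)) * P = P * (1 - (c' - e x)) := by
    rw [sub_mul, mul_sub, h2, one_mul, mul_one]
  rw [IsExceptionalSummand, IsExceptionalSummand, key _ _ hx, key _ _ h1, key _ _ h2, key _ _ h3]

theorem exists_mulVec_ne_zero {c : Matrix (Fin 2) (Fin 2) F} (hc : c ≠ 0) :
    ∃ v, c *ᵥ v ≠ 0 := by
  by_contra! h
  exact hc (Matrix.mulVec_injective (funext fun v => by simp [h]))

theorem det_ne_zero_of_mulVec {P : Matrix (Fin 2) (Fin 2) F} (h : ∀ u, P *ᵥ u = 0 → u = 0) :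
    P.det ≠ 0 := fun h0 => by
  obtain ⟨u, hu, hu'⟩ := exists_mulVec_eq_zero_iff.mpr h0
  exact hu (h u hu')

theorem of_cols_mulVec (v w u : Fin 2 → F) :
    !![v 0, w 0; v 1, w 1] *ᵥ u = u 0 • v + u 1 • w := by
  ext i; fin_cases i <;> simp [mulVec, dotProduct, Fin.sum_univ_two] <;> ring

theorem mul_of_cols (c : Matrix (Fin 2) (Fin 2) F) (v w : Fin 2 → F) :
    c * !![v 0, w 0; v 1, w 1] =
      !![(c *ᵥ v) 0, (c *ᵥ w) 0; (c *ᵥ v) 1, (c *ᵥ w) 1] := by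
  ext i j; fin_cases i <;> fin_cases j <;>
    simp [mulVec, dotProduct, mul_apply, Fin.sum_univ_two]

/-- A nonzero vector in the image of c and one in the image of 1 - c form a basis in which c becomes
E₁₁. -/
theorem exceptionalCount_eq_of_isIdempotentElem {c : Matrix (Fin 2) (Fin 2) F} (h0 : c ≠ 0)
    (h1 : c ≠ 1) (hc : IsIdempotentElem c) :
    exceptionalCount c = exceptionalCount (!![1, 0; 0, 0] : Matrix (Fin 2) (Fin 2) F) := by
  obtain ⟨v', hv⟩ := exists_mulVec_ne_zero h0
  obtain ⟨w', hw⟩ := exists_mulVec_ne_zero (sub_ne_zero.mpr (Ne.symm h1))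
  set v := c *ᵥ v' with hv'
  set w := (1 - c) *ᵥ w' with hw'
  have cv : c *ᵥ v = v := by rw [hv', mulVec_mulVec, hc.eq]
  have cw : c *ᵥ w = 0 := by
    rw [hw', mulVec_mulVec, mul_sub, mul_one, hc.eq, sub_self, zero_mulVec]
  refine exceptionalCount_eq_of_mul_eq_mul (P := !![v 0, w 0; v 1, w 1]) ?_ ?_
  · refine det_ne_zero_of_mulVec fun u hu => ?_
    rw [of_cols_mulVec] at hu
    have hu0 := congrArg (c *ᵥ ·) hu
    simp only [mulVec_add, mulVec_smul, cv, cw, smul_zero, add_zero, mulVec_zero] at hu0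
    have u0 := (smul_eq_zero.mp hu0).resolve_right hv
    rw [u0, zero_smul, zero_add] at hu
    have u1 := (smul_eq_zero.mp hu).resolve_right hw
    ext i; fin_cases i <;> simp [u0, u1]
  · rw [mul_of_cols, cv, cw]
    simp

theorem exceptionalCount_eq_of_isNilpotent {c : Matrix (Fin 2) (Fin 2) F} (h0 : c ≠ 0)
    (hc : IsNilpotent c) : exceptionalCount c = exceptionalCount (!![0, 1; 0, 0] : Matrix (Fin 2) (Fin 2) F) := by
  have hdet : c.det = 0 := by
    obtain ⟨k, hk⟩ := hc
    have := congrArg det hk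
    rw [det_pow, det_zero] at this
    exact eq_zero_of_pow_eq_zero this
  have htr : c.trace = 0 := (isNilpotent_trace_of_isNilpotent hc).eq_zero
  -- Cayley–Hamilton with trace and determinant zero. Then c w and w, for any w with c w ≠ 0, form a
  -- basis in which c becomes E₁₂.
  have hsq : c * c = 0 := by
    rw [trace_fin_two] at htr
    rw [det_fin_two] at hdet
    ext i j; fin_cases i <;> fin_cases j <;> simp [mul_apply, Fin.sum_univ_two]
    · linear_combination c 0 0 * htr - hdet
    · linear_combination c 0 1 * htr
    · linear_combination c 1 0 * htr
    · linear_combination c 1 1 * htr - hdet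
  obtain ⟨w, hv⟩ := exists_mulVec_ne_zero h0
  set v := c *ᵥ w with hv'
  have cv : c *ᵥ v = 0 := by rw [hv', mulVec_mulVec, hsq, zero_mulVec]
  refine exceptionalCount_eq_of_mul_eq_mul (P := !![v 0, w 0; v 1, w 1]) ?_ ?_
  · refine det_ne_zero_of_mulVec fun u hu => ?_
    rw [of_cols_mulVec] at hu
    have hu0 := congrArg (c *ᵥ ·) hu
    simp only [mulVec_add, mulVec_smul, cv, ← hv', smul_zero, zero_add, mulVec_zero] at hu0
    have u1 := (smul_eq_zero.mp hu0).resolve_right hv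
    rw [u1, zero_smul, add_zero] at hu
    have u0 := (smul_eq_zero.mp hu).resolve_right hv
    ext i; fin_cases i <;> simp [u0, u1]
  · rw [mul_of_cols, cv, ← hv']
    simp

/-- For c = 1 the conditions on c - x repeat those on x, so every x admissible for some c is
admissible for 1. -/
theorem exceptionalCount_le_one [Finite F] (c : Matrix (Fin 2) (Fin 2) F) :
    exceptionalCount c ≤ exceptionalCount (1 : Matrix (Fin 2) (Fin 2) F) := by
  refine Nat.card_le_card_of_injective
    (fun x => ⟨x.1, x.2.1, x.2.1.2, by rw [sub_sub_cancel]; exact x.2.1.1⟩) fun x y hxy => ?_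
  exact Subtype.ext (congrArg (fun z => z.1) hxy)

/-- Each of the four determinants vanishes on a set in bijection with the singular matrices, hence
on at most 2q³ matrices. -/
theorem le_exceptionalCount [Fintype F] (c : Matrix (Fin 2) (Fin 2) F) :
    (Fintype.card F : ℤ) ^ 4 - 8 * Fintype.card F ^ 3 ≤ exceptionalCount c := by
  classical
  let Z : Finset (Matrix (Fin 2) (Fin 2) F) := Finset.univ.filter fun x => x.det = 0
  have hZ : (Z.card : ℤ) ≤ 2 * (Fintype.card F : ℤ) ^ 3 := by
    have := card_det_eq_zero_le (F := F)
    rwa [Nat.card_eq_fintype_card, Fintype.card_subtype] at this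
  have hpre (e : Matrix (Fin 2) (Fin 2) F ≃ Matrix (Fin 2) (Fin 2) F) :
      (Finset.univ.filter fun x => (e x).det = 0).card = Z.card :=
    Finset.card_bij (fun x _ => e x) (by simp [Z]) (by simp)
      (fun y hy => ⟨e.symm y, by simpa [Z] using hy, by simp⟩)
  have hcard : Fintype.card (Matrix (Fin 2) (Fin 2) F) = Fintype.card F ^ 4 := by
    rw [← Nat.card_eq_fintype_card, Nat.card_congr (Matrix.of (m := Fin 2) (n := Fin 2)).symm]
    simp [← pow_mul]
  let E : Finset (Matrix (Fin 2) (Fin 2) F) := Finset.univ.filter fun x => IsExceptionalSummand c x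
  have hE : exceptionalCount c = E.card := by
    rw [exceptionalCount, Nat.card_eq_fintype_card, Fintype.card_subtype]
  have hcover : Finset.univ ⊆ E ∪ ((Z ∪ Finset.univ.filter fun x => ((1 - x).det = 0)) ∪
      ((Finset.univ.filter fun x => (c - x).det = 0) ∪
        Finset.univ.filter fun x => (1 - (c - x)).det = 0)) := by
    intro x _
    simp only [E, Z, Finset.mem_union, Finset.mem_filter, Finset.mem_univ, true_and]
    unfold IsExceptionalSummand
    tauto
  have hle := (Finset.card_le_card hcover).trans <| (Finset.card_union_le _ _).trans <|
    Nat.add_le_add_left ((Finset.card_union_le _ _).trans <|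
      Nat.add_le_add (Finset.card_union_le _ _) (Finset.card_union_le _ _)) _
  have e1 := hpre (Equiv.subLeft 1)
  have e2 := hpre (Equiv.subLeft c)
  have e3 := hpre ((Equiv.subLeft c).trans (Equiv.subLeft 1))
  simp only [Equiv.subLeft_apply, Equiv.trans_apply] at e1 e2 e3
  rw [e1, e2, e3, Finset.card_univ, hcard, ← hE] at hle
  zify at hle
  linarith

end Conjugation

/-! ### Assembling the theorem -/

/-- Exceptional pairs over `ℍ[R]` lie over exceptional pairs of matrices, and all fibres have the
size of the kernel of the reduction map. -/
theorem phi_two_quaternion_eq {R F : Type*} [CommRing R] [Field F] (π : R →+* F) [IsLocalHom π]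
    (hπ : Function.Surjective π) (h2 : (2 : F) ≠ 0) (α β : F) (h : α ^ 2 + β ^ 2 = -1)
    (c : Quaternion R) :
    phi 2 c = Nat.card (RingHom.ker π) ^ 4 *
      exceptionalCount (quaternionToMatrix π α β h c) := by
  rw [phi_two_eq, ← card_ker_quaternionToMatrix π α β h h2, exceptionalCount,
    ← card_preimage_eq_card_ker_mul _ (quaternionToMatrix_surjective π α β h h2 hπ)]
  refine Nat.card_congr (Equiv.subtypeEquivRight fun x => ?_)
  simp only [IsExceptionalUnit, isUnit_iff_det_quaternionToMatrix_ne_zero π α β h, map_sub,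
    map_one, IsExceptionalSummand]

theorem modJ_eq_iff {R F : Type*} [CommRing R] [Field F] (π : R →+* F) [IsLocalHom π]
    (hπ : Function.Surjective π) (h2 : (2 : F) ≠ 0) (α β : F) (h : α ^ 2 + β ^ 2 = -1)
    (c d : Quaternion R) :
    modJ c = modJ d ↔ quaternionToMatrix π α β h c = quaternionToMatrix π α β h d := by
  rw [modJ, modJ, Ideal.Quotient.eq, ← ker_quaternionToMatrix π α β h h2 hπ, RingHom.mem_ker,
    map_sub, sub_eq_zero]

theorem theorem4p9 {R : Type*} [CommRing R] [Finite R] [IsLocalRing R]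
    (p n r : ℕ) (hp : p.Prime) (hp2 : 2 < p)
    (hR : Nat.card R = p ^ (n * r))
    (hF : Nat.card (R ⧸ Ring.jacobson R) = p ^ r)
    (c : Quaternion R) :
    (modJ c = 0 →
      (phi 2 c : ℤ) = (p : ℤ) ^ ((4 * n - 3) * r) *
        ((p : ℤ) ^ (3 * r) - 3 * (p : ℤ) ^ (2 * r) + 6)) ∧
    (modJ c = 1 →
      (phi 2 c : ℤ) = (p : ℤ) ^ ((4 * n - 3) * r) *
        ((p : ℤ) ^ (3 * r) - 2 * (p : ℤ) ^ (2 * r) - (p : ℤ) ^ r + 3)) ∧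
    (modJ c ≠ 0 → modJ c ≠ 1 → IsIdempotentElem (modJ c) →
      (phi 2 c : ℤ) = (p : ℤ) ^ (4 * (n - 1) * r) *
        ((p : ℤ) ^ (4 * r) - 4 * (p : ℤ) ^ (3 * r) + 5 * (p : ℤ) ^ (2 * r)
          - 4 * (p : ℤ) ^ r + 4)) ∧
    (modJ c ≠ 0 → IsNilpotent (modJ c) →
      (phi 2 c : ℤ) = (p : ℤ) ^ ((4 * n - 3) * r) *
        ((p : ℤ) ^ (3 * r) - 4 * (p : ℤ) ^ (2 * r) + 3 * (p : ℤ) ^ r + 2)) ∧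
    (IsUnit c →
      (phi 2 c : ℤ) ≤ (p : ℤ) ^ ((4 * n - 3) * r) *
        ((p : ℤ) ^ (3 * r) - 2 * (p : ℤ) ^ (2 * r) - (p : ℤ) ^ r + 3)) ∧
    (9 ≤ p ^ r →
      (p : ℤ) ^ ((4 * n - 3) * r) * ((p : ℤ) ^ (3 * r) - 8 * (p : ℤ) ^ (2 * r))
          ≤ (phi 2 c : ℤ) ∧
      -- `lam` acts on `H(R)/J(H(R))` through any of its representatives `l` in `R`
      ∀ lam : R ⧸ Ring.jacobson R, lam ≠ 0 → lam ≠ 1 →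
        (∃ l : R, modJ l = lam ∧
          modJ c ^ 2 = modJ (algebraMap R (Quaternion R) l) * modJ c) →
        (phi 2 c : ℚ) ≤ (p : ℚ) ^ ((4 * n - 3) * r) / ((p : ℚ) ^ r - 8) *
          ((p : ℚ) ^ (4 * r) - 4 * (p : ℚ) ^ (3 * r) + 5 * (p : ℚ) ^ (2 * r)
            - 4 * (p : ℚ) ^ r + 4)) := by
  classical
  let F := IsLocalRing.ResidueField R
  let π : R →+* F := IsLocalRing.residue R
  have hπ : Function.Surjective π := IsLocalRing.residue_surjective
  have : Finite F := Finite.of_surjective π hπ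
  have := Fintype.ofFinite F
  have hker : RingHom.ker π = Ring.jacobson R := by
    rw [IsLocalRing.ringJacobson_eq_maximalIdeal]; exact IsLocalRing.ker_residue
  have hFc : Fintype.card F = p ^ r := by
    rw [← Nat.card_eq_fintype_card, ← hF, IsLocalRing.ringJacobson_eq_maximalIdeal]
    rfl
  have h2 : (2 : F) ≠ 0 := by
    intro h
    have : (2 : ℕ) ∣ Fintype.card F := by
      have hch : CharP F 2 := CharTwo.of_one_ne_zero_of_two_eq_zero one_ne_zero h
      exact (CharP.cast_eq_zero_iff F 2 _).mp (FiniteField.cast_card_eq_zero F)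
    rw [hFc] at this
    exact hp2.ne ((Nat.prime_dvd_prime_iff_eq Nat.prime_two hp).mp
      (Nat.prime_two.dvd_of_dvd_pow this))
  -- A local ring is nontrivial, which excludes n = 0; the truncated subtractions n - 1 and 4n - 3
  -- are then genuine.
  have hn : 1 ≤ n := by
    rw [Nat.one_le_iff_ne_zero]
    rintro rfl
    have := Finite.one_lt_card (α := R)
    simp [hR] at this
  have hK : Nat.card (RingHom.ker π) = p ^ ((n - 1) * r) := by
    have h := Submodule.card_eq_card_quotient_mul_card (RingHom.ker π)
    rw [hR, hker, hF] at h
    rw [hker]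
    obtain ⟨m, rfl⟩ := Nat.exists_eq_add_of_le hn
    refine (Nat.eq_of_mul_eq_mul_left (pow_pos hp.pos r) ?_)
    rw [← pow_add, Nat.add_sub_cancel_left, mul_comm (p ^ r), ← h]
    ring_nf
  obtain ⟨α, β, hαβ⟩ := exists_sq_add_sq_eq_neg_one (F := F) h2
  set f := quaternionToMatrix π α β hαβ with hf
  have hphi : (phi 2 c : ℤ) = (p : ℤ) ^ (4 * (n - 1) * r) * exceptionalCount (f c) := by
    rw [phi_two_quaternion_eq π hπ h2 α β hαβ, hK, ← pow_mul, ← hf]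
    push_cast
    ring_nf
  have hpow : (p : ℤ) ^ ((4 * n - 3) * r) = (p : ℤ) ^ (4 * (n - 1) * r) * (p : ℤ) ^ r := by
    rw [← pow_add]
    congr 1
    obtain ⟨m, rfl⟩ := Nat.exists_eq_add_of_le hn
    rw [Nat.add_sub_cancel_left, show 4 * (1 + m) - 3 = 4 * m + 1 by omega]
    ring
  -- Being 0, 1, idempotent or nilpotent is a matter of equations between classes, so each property
  -- passes between the class of c and the matrix `f c`.
  have hmod (a b : Quaternion R) : modJ a = modJ b ↔ f a = f b := modJ_eq_iff π hπ h2 α β hαβ a b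
  have hzero : modJ c = 0 ↔ f c = 0 := by simpa using hmod c 0
  have hone : modJ c = 1 ↔ f c = 1 := by simpa using hmod c 1
  have hid : IsIdempotentElem (modJ c) ↔ IsIdempotentElem (f c) := by
    simpa [IsIdempotentElem] using hmod (c * c) c
  have hnil : IsNilpotent (modJ c) ↔ IsNilpotent (f c) := by
    refine exists_congr fun k => ?_
    simpa using hmod (c ^ k) 0
  have hQ : (Fintype.card F : ℤ) = (p : ℤ) ^ r := by rw [hFc]; push_cast; rfl
  have hpos : (0 : ℤ) ≤ (p : ℤ) ^ (4 * (n - 1) * r) := by positivity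
  have hupper : (phi 2 c : ℤ) ≤ (p : ℤ) ^ ((4 * n - 3) * r) *
      ((p : ℤ) ^ (3 * r) - 2 * (p : ℤ) ^ (2 * r) - (p : ℤ) ^ r + 3) := by
    have h1 : (exceptionalCount (f c) : ℤ) ≤ exceptionalCount (1 : Matrix (Fin 2) (Fin 2) F) :=
      mod_cast exceptionalCount_le_one (f c)
    rw [exceptionalCount_one, hQ] at h1
    rw [hphi, hpow]
    exact (mul_le_mul_of_nonneg_left h1 hpos).trans_eq (by ring)
  refine ⟨fun h => ?_, fun h => ?_, fun h0 h1 hi => ?_, fun h0 hn => ?_, fun _ => hupper,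
    fun h9 => ⟨?_, fun _ _ _ _ => ?_⟩⟩
  · rw [hphi, hzero.mp h, exceptionalCount_zero h2, hQ, hpow]
    ring
  · rw [hphi, hone.mp h, exceptionalCount_one, hQ, hpow]
    ring
  · rw [hphi, exceptionalCount_eq_of_isIdempotentElem (hzero.not.mp h0) (hone.not.mp h1)
      (hid.mp hi), exceptionalCount_idempotent h2, hQ]
    ring
  · rw [hphi, exceptionalCount_eq_of_isNilpotent (hzero.not.mp h0) (hnil.mp hn),
      exceptionalCount_nilpotent h2, hQ, hpow]
    ring
  · have h1 := mul_le_mul_of_nonneg_left (le_exceptionalCount (f c)) hpos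
    rw [← hphi, hQ] at h1
    refine le_trans (le_of_eq ?_) h1
    rw [hpow]
    ring
  · have hq : (9 : ℚ) ≤ (p : ℚ) ^ r := mod_cast h9
    have hupper' : (phi 2 c : ℚ) ≤ (p : ℚ) ^ ((4 * n - 3) * r) *
      ((p : ℚ) ^ (3 * r) - 2 * (p : ℚ) ^ (2 * r) - (p : ℚ) ^ r + 3) := by exact_mod_cast hupper
    refine hupper'.trans ?_
    rw [div_mul_eq_mul_div, mul_div_assoc]
    refine mul_le_mul_of_nonneg_left ?_ (by positivity)
    -- After clearing q - 8, the right side exceeds the left by 6q³ - 10q² - 15q + 28, which is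
    -- positive for q ≥ 9.
    rw [le_div_iff₀ (by linarith), mul_comm 4 r, mul_comm 3 r, mul_comm 2 r, pow_mul, pow_mul,
      pow_mul]
    generalize (p : ℚ) ^ r = q at hq
    nlinarith [mul_nonneg (sq_nonneg q) (by linarith : (0 : ℚ) ≤ q - 9),
      mul_nonneg (by linarith : (0 : ℚ) ≤ q) (by linarith : (0 : ℚ) ≤ q - 9)]
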